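/- All actions on metric spaces are by isometries. A hyperbolic space is a geodesic metric space $S$, not necessarily proper, for which there is $\delta\ge 0$ such that each side of each geodesic triangle lies in the $\delta$-neighbourhood of the union of the other two. Let $\partial S$ denote its Gromov boundary (equivalence classes of sequences converging at infinity). For a group $G$ acting on $S$, the limit set $\Lambda(G)\subseteq\partial S$ is the set of limits in $\partial S$ of sequences of points of a $G$-orbit in $S$. The action is non-elementary if $\Lambda(G)$ is infinite, and acylindrical if for every $\varepsilon>0$ there are $R,N>0$ such that for all $x,y\in S$ with $d(x,y)\ge R$ at most $N$ elements $g\in G$ satisfy $d(x,gx)\le\varepsilon$ and $d(y,gy)\le\varepsilon$. A group is acylindrically hyperbolic if it admits a non-elementary acylindrical action on a hyperbolic space. A subgroup $H\le G$ is geometrically dense with respect to an action of $G$ on $S$ if $H$ fixes no point of $\partial S$ and $\Lambda(H)=\Lambda(G)$; a subgroup $H$ of an acylindrically hyperbolic group $G$ is totally geometrically dense if it is geometrically dense with respect to every non-elementary acylindrical action of $G$ on a hyperbolic space. An invariant random subgroup (IRS) of $G$ is a Borel probability measure on the space of subgroups of $G$ (with the topology inherited from $\{0,1\}^G$) that is invariant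 under conjugation by $G$; it is ergodic if the conjugation action of $G$ is ergodic with respect to it. Let $G$ be a countable acylindrically hyperbolic group and let $\mu$ be an ergodic IRS of $G$. Then $G$ has a finite normal subgroup $K(G)$ that contains every finite normal subgroup of $G$, and at least one of the following holds: 1. $\mu$-almost every subgroup $H\le G$ is totally geometrically dense, and $\mu$-almost every subgroup $H\le G$ is acylindrically hyperbolic; 2. $\mu$-almost every subgroup $H\le G$ is contained in $K(G)$, and $\mu$-almost every subgroup $H\le G$ is finite. -/

import Mathlib

open MeasureTheory Filter
open scoped Pointwise

universe u v w

/-! ### Hyperbolic spaces -/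

section Hyperbolic

variable {S : Type v} [MetricSpace S]

/-- `σ` is (the image of) a geodesic segment from `x` to `y`. -/
def IsGeodesicSegment (x y : S) (σ : Set S) : Prop :=
  ∃ γ : ℝ → S, γ 0 = x ∧ γ (dist x y) = y ∧
    (∀ s ∈ Set.Icc 0 (dist x y), ∀ t ∈ Set.Icc 0 (dist x y), dist (γ s) (γ t) = |s - t|) ∧
    σ = γ '' Set.Icc 0 (dist x y)

variable (S) in
/-- A hyperbolic space: a geodesic metric space in which, for some `δ ≥ 0`, every side of every
geodesic triangle lies in the closed `δ`-neighbourhood of the union of the other two sides.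
No properness or completeness is assumed. -/
def IsHyperbolicSpace : Prop :=
  (∀ x y : S, ∃ σ : Set S, IsGeodesicSegment x y σ) ∧
  ∃ δ : ℝ, 0 ≤ δ ∧ ∀ (x y z : S) (σ₁ σ₂ σ₃ : Set S),
    IsGeodesicSegment x y σ₁ → IsGeodesicSegment y z σ₂ → IsGeodesicSegment z x σ₃ →
      ∀ p ∈ σ₁, ∃ q ∈ σ₂ ∪ σ₃, dist p q ≤ δ

/-- The Gromov product `(x, y)_z`. -/
noncomputable def gromovProduct (x y z : S) : ℝ :=
  (dist x z + dist y z - dist x y) / 2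

/-- `(x_i, y_j)_s → ∞` as `i, j → ∞`, for every base point `s`. -/
def AsymptoticAtInfinity (x y : ℕ → S) : Prop :=
  ∀ s : S, Tendsto (fun p : ℕ × ℕ => gromovProduct (x p.1) (y p.2) s) atTop atTop

variable (S) in
/-- Sequences in `S` that converge at infinity. -/
def SeqAtInfinity : Type v :=
  {x : ℕ → S // AsymptoticAtInfinity x x}

variable (S) in
/-- The Gromov boundary: sequences converging at infinity modulo equivalence. (For hyperbolic `S`
the relation `AsymptoticAtInfinity` is an equivalence relation on such sequences; `Quot` forms the
quotient by the equivalence relation it generates.) -/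
def GromovBoundary : Type v :=
  Quot fun x y : SeqAtInfinity S => AsymptoticAtInfinity x.1 y.1

end Hyperbolic

/-! ### Isometric actions on hyperbolic spaces -/

section Action

variable {G : Type u} [Group G] {S : Type v} [MetricSpace S] [MulAction G S]

theorem AsymptoticAtInfinity.smul [IsIsometricSMul G S] (g : G) {x y : ℕ → S}
    (h : AsymptoticAtInfinity x y) :
    AsymptoticAtInfinity (fun n => g • x n) (fun n => g • y n) := by
  intro s
  refine (h (g⁻¹ • s)).congr fun p => ?_
  have e : ∀ a : S, dist (g • a) s = dist a (g⁻¹ • s) := fun a => by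
    rw [← dist_smul g a (g⁻¹ • s), smul_inv_smul]
  simp only [gromovProduct, e, dist_smul]

/-- The induced action on the Gromov boundary: `g • [x_n] = [g • x_n]`. -/
instance GromovBoundary.instMulAction [IsIsometricSMul G S] : MulAction G (GromovBoundary S) where
  smul g := Quot.map (fun x => ⟨fun n => g • x.1 n, x.2.smul g⟩) fun _ _ h => h.smul g
  one_smul := by
    rintro ⟨x⟩
    exact congrArg (Quot.mk _) (Subtype.ext (funext fun n => one_smul G (x.1 n)))
  mul_smul := by
    rintro g h ⟨x⟩
    exact congrArg (Quot.mk _) (Subtype.ext (funext fun n => mul_smul g h (x.1 n)))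

variable (G S)

/-- The limit set: boundary points that are limits of sequences of points of a `G`-orbit. -/
def limitSet : Set (GromovBoundary S) :=
  {ξ | ∃ (s : S) (x : SeqAtInfinity S),
    (∀ n, x.1 n ∈ MulAction.orbit G s) ∧ (Quot.mk _ x : GromovBoundary S) = ξ}

/-- An action is non-elementary if its limit set is infinite. -/
def IsNonelementaryAction : Prop := (limitSet G S).Infinite

/-- Acylindricity of an action. -/
def IsAcylindricalAction : Prop :=
  ∀ ε : ℝ, 0 < ε → ∃ (R : ℝ) (N : ℕ), 0 < R ∧ 0 < N ∧ ∀ x y : S, R ≤ dist x y →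
    {g : G | dist x (g • x) ≤ ε ∧ dist y (g • y) ≤ ε}.encard ≤ N

end Action

/-- A group is acylindrically hyperbolic if it admits a non-elementary acylindrical isometric
action on a hyperbolic space. -/
def IsAcylindricallyHyperbolic (G : Type u) [Group G] : Prop :=
  ∃ (S : Type v) (_ : MetricSpace S) (_ : MulAction G S),
    IsIsometricSMul G S ∧ IsHyperbolicSpace S ∧
      IsNonelementaryAction G S ∧ IsAcylindricalAction G S

section Dense

variable {G : Type u} [Group G]

/-- `H` is geometrically dense with respect to the action of `G` on `S`: it fixes no point of the
boundary and has the same limit set as `G`. -/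
def IsGeometricallyDense (H : Subgroup G) (S : Type v) [MetricSpace S] [MulAction G S]
    [IsIsometricSMul G S] : Prop :=
  (¬ ∃ ξ : GromovBoundary S, ∀ h ∈ H, h • ξ = ξ) ∧ limitSet H S = limitSet G S

/-- `H` is geometrically dense with respect to every non-elementary acylindrical isometric action
of `G` on a hyperbolic space. -/
def IsTotallyGeometricallyDense (H : Subgroup G) : Prop :=
  ∀ (S : Type v) [MetricSpace S] [MulAction G S] [IsIsometricSMul G S],
    IsHyperbolicSpace S → IsNonelementaryAction G S → IsAcylindricalAction G S →
      IsGeometricallyDense H S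

end Dense

/-- The subgroup generated by all finite normal subgroups. It is the maximal finite normal subgroup
`K(G)` whenever the latter exists. -/
def finiteRadical (G : Type u) [Group G] : Subgroup G :=
  sSup {N : Subgroup G | N.Normal ∧ Finite N}

/-! ### The space of subgroups -/

section Sub

variable {G : Type u} [Group G]

open Classical in
/-- The topology on the set of subgroups of `G` inherited from the product topology on
`{0,1}^G`. -/
noncomputable instance Subgroup.instTopologicalSpaceSub : TopologicalSpace (Subgroup G) :=
  TopologicalSpace.induced (fun (H : Subgroup G) (g : G) => decide (g ∈ H)) inferInstance

/-- The Borel σ-algebra on the space of subgroups. -/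
noncomputable instance Subgroup.instMeasurableSpaceSub : MeasurableSpace (Subgroup G) :=
  borel (Subgroup G)

instance Subgroup.instBorelSpaceSub : BorelSpace (Subgroup G) := ⟨rfl⟩

/-- An ergodic invariant random subgroup of `G`: a Borel probability measure on the space of
subgroups, invariant and ergodic under the action of `G` by conjugation. -/
structure IsErgodicIRS (μ : Measure (Subgroup G)) : Prop where
  isProbabilityMeasure : IsProbabilityMeasure μ
  ergodicSMul : ErgodicSMul (ConjAct G) (Subgroup G) μ

end Sub

/-!
Poincaré recurrence for the conjugation action shows that almost every subgroup `H` is recurrent: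
if `h ∈ H` and `g ∈ G`, then `g⁻ⁿ h gⁿ ∈ H` for infinitely many `n`.

In an acylindrical action on a hyperbolic space, let `g` be loxodromic and suppose that `h` moves
its attracting point. Then the points `g⁻ⁿ h gⁿ o` converge to the repelling point of `g`, and
`g⁻ⁿ h gⁿ` eventually moves any given boundary point other than the repelling one. Moreover, the two
endpoints of `g` have the same stabiliser, since an element fixing the attracting point commutes
with a power of `g`. Hence a recurrent subgroup that fixes some boundary point fixes the endpoints
of all loxodromic elements, and one that fixes none has all these endpoints in its limit set. They
are dense in `Λ(G)`, so in the latter case `H` is geometrically dense.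

The pointwise stabiliser of the endpoints is normal, and it is finite because an element fixing
three boundary points moves a base point by a bounded amount. It contains every finite normal
subgroup, as the points `g⁻ⁿ h gⁿ o` cannot go to infinity when `h` lies in one. It is therefore the
finite radical whatever the action is, and by ergodicity the event that it contains `H` has
probability zero or one.
-/

section GromovProduct

variable {S : Type v} [MetricSpace S]

theorem gromovProduct_comm (x y o : S) : gromovProduct x y o = gromovProduct y x o := by
  simp only [gromovProduct, dist_comm x y]; ring

theorem gromovProduct_self (x o : S) : gromovProduct x x o = dist x o := by
  simp [gromovProduct]

theorem gromovProduct_base_right (x o : S) : gromovProduct x o o = 0 := by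
  simp [gromovProduct]

theorem gromovProduct_nonneg (x y o : S) : 0 ≤ gromovProduct x y o := by
  have := dist_triangle_right x y o
  simp only [gromovProduct]; linarith

theorem gromovProduct_le_dist_left (x y o : S) : gromovProduct x y o ≤ dist x o := by
  have := dist_triangle y x o
  simp only [gromovProduct, dist_comm x y]; linarith

theorem gromovProduct_le_add_dist_base (x y o s : S) :
    gromovProduct x y o ≤ gromovProduct x y s + dist o s := by
  have h1 := dist_triangle x s o
  have h2 := dist_triangle y s o
  rw [dist_comm s o] at h1 h2
  simp only [gromovProduct]; linarith

theorem gromovProduct_le_add_dist_left (x x' y o : S) :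
    gromovProduct x y o ≤ gromovProduct x' y o + dist x x' := by
  have h1 := dist_triangle x x' o
  have h2 := dist_triangle x' x y
  rw [dist_comm x' x] at h2
  simp only [gromovProduct]; linarith

theorem gromovProduct_add_swap (x y o : S) :
    gromovProduct x y o + gromovProduct o x y = dist o y := by
  simp only [gromovProduct, dist_comm o x, dist_comm y o]; ring

end GromovProduct

section ThinTriangles

variable {S : Type v} [MetricSpace S]

variable (S) in
/-- The four-point (Gromov product) form of hyperbolicity, which is the form used for estimates
at infinity. -/
def IsGromovHyperbolic (δ : ℝ) : Prop :=
  ∀ x y z o : S, min (gromovProduct x y o) (gromovProduct y z o) ≤ gromovProduct x z o + δ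

namespace IsGromovHyperbolic

variable {δ : ℝ}

theorem nonneg (hδ : IsGromovHyperbolic S δ) (o : S) : 0 ≤ δ := by
  simpa [gromovProduct] using hδ o o o o

theorem le_gromovProduct (hδ : IsGromovHyperbolic S δ) {M : ℝ} {x y z o : S}
    (hxy : M + δ ≤ gromovProduct x y o) (hyz : M + δ ≤ gromovProduct y z o) :
    M ≤ gromovProduct x z o := by
  linarith [hδ x y z o, le_min hxy hyz]

theorem gromovProduct_le_of_lt (hδ : IsGromovHyperbolic S δ) {C : ℝ} {x y z o : S}
    (hxz : gromovProduct x z o ≤ C) (hyz : C + δ < gromovProduct y z o) :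
    gromovProduct x y o ≤ C + δ := by
  rcases min_le_iff.1 (hδ x y z o) with h | h <;> linarith

end IsGromovHyperbolic

namespace IsGeodesicSegment

variable {x y p : S} {σ : Set S}

theorem dist_add_dist (h : IsGeodesicSegment x y σ) (hp : p ∈ σ) :
    dist x p + dist p y = dist x y := by
  obtain ⟨γ, h0, h1, hγ, rfl⟩ := h
  obtain ⟨t, ht, rfl⟩ := hp
  have hxp := hγ 0 ⟨le_rfl, dist_nonneg⟩ t ht
  have hpy := hγ t ht _ ⟨dist_nonneg, le_rfl⟩
  rw [h0] at hxp
  rw [h1] at hpy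
  rw [hxp, hpy, abs_of_nonpos (by linarith [ht.1]), abs_of_nonpos (by linarith [ht.2])]
  ring

theorem left_mem (h : IsGeodesicSegment x y σ) : x ∈ σ := by
  obtain ⟨γ, h0, -, -, rfl⟩ := h
  exact ⟨0, ⟨le_rfl, dist_nonneg⟩, h0⟩

theorem right_mem (h : IsGeodesicSegment x y σ) : y ∈ σ := by
  obtain ⟨γ, -, h1, -, rfl⟩ := h
  exact ⟨_, ⟨dist_nonneg, le_rfl⟩, h1⟩

theorem exists_continuousOn (h : IsGeodesicSegment x y σ) :
    ∃ γ : ℝ → S, ContinuousOn γ (Set.Icc 0 (dist x y)) ∧ σ = γ '' Set.Icc 0 (dist x y) := by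
  obtain ⟨γ, -, -, hγ, rfl⟩ := h
  refine ⟨γ, (LipschitzOnWith.of_dist_le_mul (K := 1) fun s hs t ht => ?_).continuousOn, rfl⟩
  rw [hγ s hs t ht, NNReal.coe_one, one_mul, Real.dist_eq]

theorem isCompact (h : IsGeodesicSegment x y σ) : IsCompact σ := by
  obtain ⟨γ, hγ, rfl⟩ := h.exists_continuousOn
  exact isCompact_Icc.image_of_continuousOn hγ

theorem isPreconnected (h : IsGeodesicSegment x y σ) : IsPreconnected σ := by
  obtain ⟨γ, hγ, rfl⟩ := h.exists_continuousOn
  exact isPreconnected_Icc.image _ hγ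

theorem gromovProduct_le (h : IsGeodesicSegment x y σ) (hp : p ∈ σ) (o : S) :
    gromovProduct x y o ≤ dist p o := by
  have hxo := dist_triangle x p o
  have hyo := dist_triangle_left y o p
  rw [gromovProduct]
  linarith [h.dist_add_dist hp]

end IsGeodesicSegment

theorem exists_dist_le_of_isPreconnected {X : Type*} [PseudoMetricSpace X] {σ A B : Set X} {δ : ℝ}
    (hδ : 0 ≤ δ) (hσ : IsPreconnected σ) (hA : IsCompact A) (hB : IsCompact B)
    (hcover : ∀ p ∈ σ, ∃ q ∈ A ∪ B, dist p q ≤ δ) (hσA : (σ ∩ A).Nonempty)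
    (hσB : (σ ∩ B).Nonempty) :
    ∃ p ∈ σ, (∃ q ∈ A, dist p q ≤ δ) ∧ ∃ r ∈ B, dist p r ≤ δ := by
  have mem_iff : ∀ {K : Set X}, IsCompact K → ∀ p : X,
      p ∈ Metric.cthickening δ K ↔ ∃ q ∈ K, dist p q ≤ δ := fun hK p => by
    simp only [hK.cthickening_eq_biUnion_closedBall hδ, Set.mem_iUnion, Metric.mem_closedBall,
      exists_prop]
  have hsubset : σ ⊆ Metric.cthickening δ A ∪ Metric.cthickening δ B := fun p hp => by
    obtain ⟨q, hq | hq, hpq⟩ := hcover p hp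
    · exact Or.inl ((mem_iff hA p).2 ⟨q, hq, hpq⟩)
    · exact Or.inr ((mem_iff hB p).2 ⟨q, hq, hpq⟩)
  obtain ⟨p, hp, hpA, hpB⟩ := isPreconnected_closed_iff.1 hσ _ _ Metric.isClosed_cthickening
    Metric.isClosed_cthickening hsubset
    (hσA.mono (Set.inter_subset_inter_right σ (Metric.self_subset_cthickening A)))
    (hσB.mono (Set.inter_subset_inter_right σ (Metric.self_subset_cthickening B)))
  exact ⟨p, hp, (mem_iff hA p).1 hpA, (mem_iff hB p).1 hpB⟩

theorem exists_mem_dist_le_gromovProduct {δ : ℝ} (hδ : 0 ≤ δ) {x y o : S} {σ₁ σ₂ σ₃ : Set S}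
    (h₁ : IsGeodesicSegment x y σ₁) (h₂ : IsGeodesicSegment y o σ₂)
    (h₃ : IsGeodesicSegment o x σ₃) (hthin : ∀ p ∈ σ₁, ∃ q ∈ σ₂ ∪ σ₃, dist p q ≤ δ) :
    ∃ p ∈ σ₁, dist p o ≤ gromovProduct x y o + 2 * δ := by
  -- A point `p` that is `δ`-close to both sides through `o` is almost as close to `o` as possible.
  obtain ⟨p, hp, ⟨q, hq, hpq⟩, r, hr, hpr⟩ := exists_dist_le_of_isPreconnected hδ
    h₁.isPreconnected h₂.isCompact h₃.isCompact hthin ⟨y, h₁.right_mem, h₂.left_mem⟩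
    ⟨x, h₁.left_mem, h₃.right_mem⟩
  refine ⟨p, hp, ?_⟩
  have hpo_q := dist_triangle p q o
  have hpo_r := dist_triangle_right p o r
  have hyp := dist_triangle_right p y q
  have hxp := dist_triangle_right x p r
  rw [gromovProduct, dist_comm x o]
  linarith [h₁.dist_add_dist hp, h₂.dist_add_dist hq, h₃.dist_add_dist hr, dist_comm x r]

theorem IsHyperbolicSpace.exists_isGromovHyperbolic (h : IsHyperbolicSpace S) :
    ∃ δ : ℝ, IsGromovHyperbolic S δ := by
  obtain ⟨hgeod, δ, hδ, hthin⟩ := h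
  refine ⟨3 * δ, fun x y z o => ?_⟩
  obtain ⟨σxz, hxz⟩ := hgeod x z
  obtain ⟨σzo, hzo⟩ := hgeod z o
  obtain ⟨σox, hox⟩ := hgeod o x
  obtain ⟨σzy, hzy⟩ := hgeod z y
  obtain ⟨σyx, hyx⟩ := hgeod y x
  obtain ⟨p, hp, hpo⟩ := exists_mem_dist_le_gromovProduct hδ hxz hzo hox
    (hthin _ _ _ _ _ _ hxz hzo hox)
  obtain ⟨q, hq, hpq⟩ := hthin _ _ _ _ _ _ hxz hzy hyx p hp
  have hqo := dist_triangle_left q o p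
  rw [gromovProduct_comm x y, gromovProduct_comm y z]
  rcases hq with hq | hq
  · exact (min_le_right _ _).trans (by linarith [hzy.gromovProduct_le hq o])
  · exact (min_le_left _ _).trans (by linarith [hyx.gromovProduct_le hq o])

end ThinTriangles

section Sequences

variable {S : Type v} [MetricSpace S] {δ : ℝ}

theorem eventually_atTop_prod_self_iff_eventually {α : Type*} [Nonempty α] [Preorder α]
    [IsDirectedOrder α] {p : α × α → Prop} :
    (∀ᶠ q in atTop, p q) ↔ ∀ᶠ N in atTop, ∀ i ≥ N, ∀ j ≥ N, p (i, j) := by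
  refine ⟨fun h => ?_, fun h => eventually_atTop_prod_self'.2 h.exists⟩
  obtain ⟨N₀, hN₀⟩ := eventually_atTop_prod_self'.1 h
  filter_upwards [eventually_ge_atTop N₀] with N hN i hi j hj
  exact hN₀ i (hN.trans hi) j (hN.trans hj)

theorem asymptoticAtInfinity_iff (o : S) {x y : ℕ → S} :
    AsymptoticAtInfinity x y ↔
      ∀ M : ℝ, ∀ᶠ N in atTop, ∀ i ≥ N, ∀ j ≥ N, M ≤ gromovProduct (x i) (y j) o := by
  have tendsto_iff : ∀ s : S,
      Tendsto (fun p : ℕ × ℕ => gromovProduct (x p.1) (y p.2) s) atTop atTop ↔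
        ∀ M : ℝ, ∀ᶠ N in atTop, ∀ i ≥ N, ∀ j ≥ N, M ≤ gromovProduct (x i) (y j) s := fun s =>
    tendsto_atTop.trans (forall_congr' fun M => eventually_atTop_prod_self_iff_eventually)
  refine ⟨fun h => (tendsto_iff o).1 (h o), fun h s => (tendsto_iff s).2 fun M => ?_⟩
  filter_upwards [h (M + dist o s)] with N hN i hi j hj
  linarith [hN i hi j hj, gromovProduct_le_add_dist_base (x i) (y j) o s]

namespace AsymptoticAtInfinity

variable {x x' y z : ℕ → S}

theorem symm (h : AsymptoticAtInfinity x y) : AsymptoticAtInfinity y x := by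
  rw [asymptoticAtInfinity_iff (x 0)] at h ⊢
  intro M
  filter_upwards [h M] with N hN i hi j hj
  exact gromovProduct_comm (x j) (y i) _ ▸ hN j hj i hi

theorem trans (hδ : IsGromovHyperbolic S δ) (hxy : AsymptoticAtInfinity x y)
    (hyz : AsymptoticAtInfinity y z) : AsymptoticAtInfinity x z := by
  rw [asymptoticAtInfinity_iff (x 0)] at hxy hyz ⊢
  intro M
  filter_upwards [hxy (M + δ), hyz (M + δ)] with N hN hN' i hi j hj
  exact hδ.le_gromovProduct (hN i hi N le_rfl) (hN' N le_rfl j hj)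

theorem of_dist_le_left {C : ℝ} (h : AsymptoticAtInfinity x y) (hC : ∀ n, dist (x n) (x' n) ≤ C) :
    AsymptoticAtInfinity x' y := by
  rw [asymptoticAtInfinity_iff (x 0)] at h ⊢
  intro M
  filter_upwards [h (M + C)] with N hN i hi j hj
  linarith [hN i hi j hj, gromovProduct_le_add_dist_left (x i) (x' i) (y j) (x 0), hC i]

theorem of_dist_le_right {C : ℝ} (h : AsymptoticAtInfinity x y)
    (hC : ∀ n, dist (y n) (z n) ≤ C) : AsymptoticAtInfinity x z :=
  (h.symm.of_dist_le_left hC).symm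

theorem comp_left (h : AsymptoticAtInfinity x y) {φ : ℕ → ℕ} (hφ : Tendsto φ atTop atTop) :
    AsymptoticAtInfinity (x ∘ φ) y := fun s =>
  (h s).comp (hφ.prod_atTop tendsto_id)

end AsymptoticAtInfinity

namespace GromovBoundary

theorem mk_eq_mk_iff (hδ : IsGromovHyperbolic S δ) {x y : SeqAtInfinity S} :
    (Quot.mk _ x : GromovBoundary S) = Quot.mk _ y ↔ AsymptoticAtInfinity x.1 y.1 :=
  Equivalence.quot_mk_eq_iff (r := fun x y : SeqAtInfinity S => AsymptoticAtInfinity x.1 y.1)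
    ⟨fun x => x.2, fun h => h.symm, fun h h' => h.trans hδ h'⟩ x y

theorem exists_gromovProduct_le_of_ne (hδ : IsGromovHyperbolic S δ) (o : S)
    {ξ η : GromovBoundary S} (hne : ξ ≠ η) :
    ∃ B : ℝ, ∀ x y : SeqAtInfinity S, Quot.mk _ x = ξ → Quot.mk _ y = η →
      ∀ᶠ N in atTop, ∀ i ≥ N, ∀ j ≥ N, gromovProduct (x.1 i) (y.1 j) o ≤ B := by
  obtain ⟨u, rfl⟩ := Quot.exists_rep ξ
  obtain ⟨v, rfl⟩ := Quot.exists_rep η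
  obtain ⟨M, hM⟩ := not_forall.1
    (mt (fun h => (mk_eq_mk_iff hδ).2 ((asymptoticAtInfinity_iff o).2 h)) hne)
  rw [not_eventually] at hM
  refine ⟨M + 2 * δ, fun x y hx hy => ?_⟩
  have hxu := (asymptoticAtInfinity_iff o).1 ((mk_eq_mk_iff hδ).1 hx) (M + 2 * δ)
  have hyv := (asymptoticAtInfinity_iff o).1 ((mk_eq_mk_iff hδ).1 hy) (M + δ)
  filter_upwards [hxu, hyv] with N hNx hNy i hi j hj
  obtain ⟨N', hN', hlt⟩ := (hM.and_eventually (eventually_ge_atTop N)).exists.imp fun _ h => h.symm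
  push Not at hlt
  obtain ⟨i', hi', j', hj', hlt⟩ := hlt
  by_contra! hgt
  refine hlt.not_ge (hδ.le_gromovProduct (y := y.1 j) (hδ.le_gromovProduct (y := x.1 i) ?_ ?_) ?_)
  · rw [gromovProduct_comm]
    linarith [hNx i hi i' (hN'.trans hi')]
  · linarith
  · exact hNy j hj j' (hN'.trans hj')

end GromovBoundary

end Sequences

section IsometricActions

variable {G : Type u} [Group G] {S : Type v} [MetricSpace S] [MulAction G S] [IsIsometricSMul G S]

theorem dist_smul_left_eq_dist_inv_smul (g : G) (x y : S) : dist (g • x) y = dist x (g⁻¹ • y) := by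
  rw [← dist_smul g x (g⁻¹ • y), smul_inv_smul]

theorem dist_inv_smul_self (g : G) (o : S) : dist (g⁻¹ • o) o = dist (g • o) o := by
  rw [dist_comm, dist_smul_left_eq_dist_inv_smul]

theorem gromovProduct_smul (g : G) (x y o : S) :
    gromovProduct (g • x) (g • y) (g • o) = gromovProduct x y o := by
  simp only [gromovProduct, dist_smul]

theorem gromovProduct_smul_smul (g : G) (x y o : S) :
    gromovProduct (g • x) (g • y) o = gromovProduct x y (g⁻¹ • o) := by
  rw [← gromovProduct_smul g x y (g⁻¹ • o), smul_inv_smul]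

theorem dist_mul_smul_self (a b : G) (o : S) :
    dist ((a * b) • o) o =
      dist (a • o) o + dist (b • o) o - 2 * gromovProduct (a⁻¹ • o) (b • o) o := by
  rw [gromovProduct, dist_inv_smul_self, mul_smul, dist_smul_left_eq_dist_inv_smul, dist_comm]
  ring

theorem gromovProduct_smul_add_gromovProduct_inv_smul (a : G) (p o : S) :
    gromovProduct (a • p) (a • o) o + gromovProduct (a⁻¹ • o) p o = dist (a • o) o := by
  rw [← gromovProduct_smul a (a⁻¹ • o), smul_inv_smul, gromovProduct_add_swap, dist_comm]

theorem mem_limitSet_iff (o : S) {ξ : GromovBoundary S} :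
    ξ ∈ limitSet G S ↔
      ∃ (a : ℕ → G) (h : AsymptoticAtInfinity (fun n => a n • o) (fun n => a n • o)),
        (Quot.mk _ ⟨fun n => a n • o, h⟩ : GromovBoundary S) = ξ := by
  constructor
  · rintro ⟨s, x, hx, rfl⟩
    choose a ha using hx
    have hdist : ∀ n, dist (x.1 n) (a n • o) ≤ dist s o := fun n => by
      rw [← ha n]; exact (dist_smul (a n) s o).le
    have hxa := x.2.of_dist_le_left hdist
    exact ⟨a, hxa.of_dist_le_right hdist, Quot.sound hxa⟩
  · rintro ⟨a, h, rfl⟩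
    exact ⟨o, _, fun n => ⟨a n, rfl⟩, rfl⟩

end IsometricActions

section Loxodromic

variable {G : Type u} [Group G] {S : Type v} [MetricSpace S] [MulAction G S]
  {δ : ℝ} {o : S} {g : G}

/-- `g` acts loxodromically: the half-orbits of `o` under `g` and `g⁻¹` go to infinity in different
directions. The condition does not depend on `o`, see `IsLoxodromicAt.change_base`. -/
structure IsLoxodromicAt (o : S) (g : G) : Prop where
  exists_gromovProduct_le :
    ∃ A : ℝ, ∀ m n : ℕ, gromovProduct (g ^ m • o) (g⁻¹ ^ n • o) o ≤ A
  tendsto_dist : Tendsto (fun n : ℕ => dist (g ^ n • o) o) atTop atTop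

theorem IsLoxodromicAt.pow (h : IsLoxodromicAt o g) {p : ℕ} (hp : 0 < p) :
    IsLoxodromicAt o (g ^ p) := by
  obtain ⟨⟨A, hA⟩, htendsto⟩ := h
  refine ⟨⟨A, fun m n => ?_⟩, ?_⟩
  · rw [← pow_mul, ← inv_pow, ← pow_mul]; exact hA _ _
  · simp only [← pow_mul]
    exact htendsto.comp (strictMono_mul_left_of_pos hp).tendsto_atTop

variable [IsIsometricSMul G S]

theorem gromovProduct_inv_smul_pow_smul_le (hδ : IsGromovHyperbolic S δ) {a : ℝ}
    (ha : gromovProduct (g • o) (g⁻¹ • o) o ≤ a) (hL : 2 * a + 2 * δ < dist (g • o) o) (n : ℕ) :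
    gromovProduct (g⁻¹ • o) (g ^ n • o) o ≤ a + δ := by
  induction n with
  | zero =>
    rw [pow_zero, one_smul, gromovProduct_base_right]
    linarith [gromovProduct_nonneg (g • o) (g⁻¹ • o) o, hδ.nonneg o]
  | succ n ih =>
    have hsum := gromovProduct_smul_add_gromovProduct_inv_smul g (g ^ n • o) o
    rw [pow_succ', mul_smul]
    rw [gromovProduct_comm] at ha
    exact hδ.gromovProduct_le_of_lt ha (by linarith)

theorem mul_le_dist_pow_smul (hδ : IsGromovHyperbolic S δ) {a : ℝ}
    (ha : gromovProduct (g • o) (g⁻¹ • o) o ≤ a) (hL : 2 * a + 2 * δ < dist (g • o) o) (n : ℕ) :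
    n * (dist (g • o) o - 2 * (a + δ)) ≤ dist (g ^ n • o) o := by
  induction n with
  | zero => simp
  | succ n ih =>
    rw [pow_succ', dist_mul_smul_self]
    push_cast
    linarith [gromovProduct_inv_smul_pow_smul_le hδ ha hL n]

theorem isLoxodromicAt_of_gromovProduct_le (hδ : IsGromovHyperbolic S δ) {a : ℝ}
    (ha : gromovProduct (g • o) (g⁻¹ • o) o ≤ a) (hL : 2 * a + 3 * δ < dist (g • o) o) :
    IsLoxodromicAt o g := by
  have hδ0 := hδ.nonneg o
  have hL' : 2 * a + 2 * δ < dist (g • o) o := by linarith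
  refine ⟨⟨a + 2 * δ, fun m n => ?_⟩, ?_⟩
  · cases n with
    | zero =>
      rw [pow_zero, one_smul, gromovProduct_base_right]
      linarith [gromovProduct_nonneg (g • o) (g⁻¹ • o) o]
    | succ n =>
      have hm := gromovProduct_inv_smul_pow_smul_le hδ ha hL' m
      have hn := gromovProduct_inv_smul_pow_smul_le (g := g⁻¹) (o := o) (a := a) hδ
        (by rwa [inv_inv, gromovProduct_comm]) (by rwa [dist_inv_smul_self]) n
      have hsum := gromovProduct_smul_add_gromovProduct_inv_smul g⁻¹ (g⁻¹ ^ n • o) o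
      rw [dist_inv_smul_self] at hsum
      rw [gromovProduct_comm] at hm
      rw [pow_succ', mul_smul]
      linarith [hδ.gromovProduct_le_of_lt (y := g⁻¹ • g⁻¹ ^ n • o) hm (by linarith)]
  · exact tendsto_atTop_mono (mul_le_dist_pow_smul hδ ha hL')
      (tendsto_natCast_atTop_atTop.atTop_mul_const (by linarith))

-- If neither `a` nor `b` is loxodromic, both backtrack so much that `a * b` does not.
theorem exists_isLoxodromicAt_of_gromovProduct_le (hδ : IsGromovHyperbolic S δ) {a b : G} {C : ℝ}
    (hC : gromovProduct (a • o) (b • o) o ≤ C) (ha : 2 * C + 8 * δ < dist (a • o) o)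
    (hb : 2 * C + 8 * δ < dist (b • o) o) : ∃ g : G, IsLoxodromicAt o g := by
  by_contra! hnot
  have hδ0 := hδ.nonneg o
  have hback : ∀ g : G, 2 * C + 8 * δ < dist (g • o) o →
      C + 2 * δ < gromovProduct (g⁻¹ • o) (g • o) o := fun g hg => by
    by_contra! hle
    rw [gromovProduct_comm] at hle
    exact hnot g (isLoxodromicAt_of_gromovProduct_le hδ hle (by linarith))
  have hb_ainv : gromovProduct (b • o) (a⁻¹ • o) o ≤ C + δ :=
    hδ.gromovProduct_le_of_lt (gromovProduct_comm (a • o) _ _ ▸ hC) (by linarith [hback a ha])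
  have ha_binv : gromovProduct (a • o) (b⁻¹ • o) o ≤ C + δ :=
    hδ.gromovProduct_le_of_lt hC (by linarith [hback b hb])
  have hab_a := gromovProduct_smul_add_gromovProduct_inv_smul a (b • o) o
  have hab_binv := gromovProduct_smul_add_gromovProduct_inv_smul b⁻¹ (a⁻¹ • o) o
  have hab := dist_mul_smul_self a b o
  rw [inv_inv, dist_inv_smul_self, ← mul_smul, ← mul_inv_rev] at hab_binv
  rw [gromovProduct_comm (a⁻¹ • o)] at hab hab_a
  rw [← mul_smul] at hab_a
  have ha_abinv : gromovProduct (a • o) ((a * b)⁻¹ • o) o ≤ C + δ + δ :=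
    hδ.gromovProduct_le_of_lt ha_binv (by linarith)
  have hab_abinv : gromovProduct ((a * b)⁻¹ • o) ((a * b) • o) o ≤ C + δ + δ + δ :=
    hδ.gromovProduct_le_of_lt (gromovProduct_comm (a • o) _ _ ▸ ha_abinv) (by linarith)
  exact hnot (a * b) (isLoxodromicAt_of_gromovProduct_le hδ
    (gromovProduct_comm ((a * b)⁻¹ • o) _ _ ▸ hab_abinv) (by linarith))

theorem exists_isLoxodromicAt (hδ : IsGromovHyperbolic S δ) (o : S)
    (h : (limitSet G S).Nontrivial) : ∃ g : G, IsLoxodromicAt o g := by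
  obtain ⟨ξ, hξ, η, hη, hne⟩ := h
  obtain ⟨C, hC⟩ := GromovBoundary.exists_gromovProduct_le_of_ne hδ o hne
  obtain ⟨a, ha, rfl⟩ := (mem_limitSet_iff o).1 hξ
  obtain ⟨b, hb, rfl⟩ := (mem_limitSet_iff o).1 hη
  obtain ⟨n, hCn, han, hbn⟩ := ((hC _ _ rfl rfl).and
    (((asymptoticAtInfinity_iff o).1 ha (2 * C + 8 * δ + 1)).and
      ((asymptoticAtInfinity_iff o).1 hb (2 * C + 8 * δ + 1)))).exists
  have hda := han n le_rfl n le_rfl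
  have hdb := hbn n le_rfl n le_rfl
  rw [gromovProduct_self] at hda hdb
  exact exists_isLoxodromicAt_of_gromovProduct_le hδ (hCn n le_rfl n le_rfl) (by linarith)
    (by linarith)

namespace IsLoxodromicAt

theorem inv (h : IsLoxodromicAt o g) : IsLoxodromicAt o g⁻¹ := by
  obtain ⟨⟨A, hA⟩, htendsto⟩ := h
  refine ⟨⟨A, fun m n => ?_⟩, htendsto.congr fun n => ?_⟩
  · rw [inv_inv, gromovProduct_comm]; exact hA n m
  · rw [inv_pow, dist_inv_smul_self]

theorem change_base (h : IsLoxodromicAt o g) (o' : S) : IsLoxodromicAt o' g := by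
  obtain ⟨⟨A, hA⟩, htendsto⟩ := h
  refine ⟨⟨A + 3 * dist o' o, fun m n => ?_⟩, ?_⟩
  · have hleft := gromovProduct_le_add_dist_left (g ^ m • o') (g ^ m • o) (g⁻¹ ^ n • o') o'
    have hright := gromovProduct_le_add_dist_left (g⁻¹ ^ n • o') (g⁻¹ ^ n • o) (g ^ m • o) o'
    have hbase := gromovProduct_le_add_dist_base (g ^ m • o) (g⁻¹ ^ n • o) o' o
    rw [dist_smul] at hleft hright
    rw [gromovProduct_comm, gromovProduct_comm (g⁻¹ ^ n • o)] at hright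
    linarith [hA m n]
  · refine tendsto_atTop_mono (fun n => ?_)
      (tendsto_atTop_add_const_right _ (-(2 * dist o' o)) htendsto)
    have := dist_triangle4 (g ^ n • o) (g ^ n • o') o' o
    rw [dist_smul, dist_comm o o'] at this
    linarith

theorem conj (h : IsLoxodromicAt o g) (a : G) : IsLoxodromicAt o (a * g * a⁻¹) := by
  obtain ⟨⟨A, hA⟩, htendsto⟩ := h
  have hconj : ∀ k : G, (a * k * a⁻¹) • a • o = a • k • o := fun k => by
    rw [mul_smul, inv_smul_smul, mul_smul]
  have hinv : (a * g * a⁻¹)⁻¹ = a * g⁻¹ * a⁻¹ := by group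
  refine change_base (o := a • o) ⟨⟨A, fun m n => ?_⟩, htendsto.congr fun n => ?_⟩ o
  · rw [hinv, conj_pow, conj_pow, hconj, hconj, gromovProduct_smul]; exact hA m n
  · rw [conj_pow, hconj, dist_smul]

theorem dist_sub_le_gromovProduct {A : ℝ}
    (hA : ∀ m n : ℕ, gromovProduct (g ^ m • o) (g⁻¹ ^ n • o) o ≤ A) {m n : ℕ} (hmn : m ≤ n) :
    dist (g ^ m • o) o - A ≤ gromovProduct (g ^ n • o) (g ^ m • o) o := by
  obtain ⟨k, rfl⟩ := Nat.exists_eq_add_of_le hmn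
  have hsum := gromovProduct_smul_add_gromovProduct_inv_smul (g ^ m) (g ^ k • o) o
  rw [← mul_smul, ← pow_add, gromovProduct_comm (_⁻¹ • o), ← inv_pow] at hsum
  linarith [hA k m]

theorem asymptotic (h : IsLoxodromicAt o g) :
    AsymptoticAtInfinity (fun n : ℕ => g ^ n • o) (fun n : ℕ => g ^ n • o) := by
  obtain ⟨A, hA⟩ := h.exists_gromovProduct_le
  rw [asymptoticAtInfinity_iff o]
  intro M
  filter_upwards [eventually_forall_ge_atTop.2 (h.tendsto_dist.eventually_ge_atTop (M + A))]
    with N hN i hi j hj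
  rcases le_total i j with hij | hij
  · rw [gromovProduct_comm]
    linarith [dist_sub_le_gromovProduct hA hij, hN i hi]
  · linarith [dist_sub_le_gromovProduct hA hij, hN j hj]

/-- The attracting boundary point of a loxodromic element, the limit of `g ^ n • o`. The repelling
point is `h.inv.attracting`. -/
def attracting (h : IsLoxodromicAt o g) : GromovBoundary S :=
  Quot.mk _ ⟨fun n : ℕ => g ^ n • o, h.asymptotic⟩

theorem attracting_congr {g' : G} (h : IsLoxodromicAt o g) (h' : IsLoxodromicAt o g')
    (hg : g = g') : h.attracting = h'.attracting := by
  subst hg; rfl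

theorem smul_attracting (h : IsLoxodromicAt o g) (a : G) :
    a • h.attracting = (h.conj a).attracting := by
  refine Quot.sound ((h.asymptotic.smul a).of_dist_le_right (C := dist o (a⁻¹ • o)) fun n => ?_)
  simp only [conj_pow, mul_smul, dist_smul, le_refl]

theorem attracting_pow (h : IsLoxodromicAt o g) {p : ℕ} (hp : 0 < p) :
    (h.pow hp).attracting = h.attracting := by
  refine Quot.sound ?_
  simp only [← pow_mul]
  exact h.asymptotic.comp_left (strictMono_mul_left_of_pos hp).tendsto_atTop

end IsLoxodromicAt

end Loxodromic

section BoundaryNeighbourhoods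

namespace GromovBoundary

variable {S : Type v} [MetricSpace S] {δ : ℝ} {o : S} {ξ η : GromovBoundary S} {M : ℝ}

/-- The points `η` of the Gromov boundary with `(ξ, η)_o ≥ M`, a basic neighbourhood of `ξ`. Since
Gromov products of representing sequences only determine `(ξ, η)_o` up to a bounded error, the
inequality is required of all representatives. -/
def basicNhd (o : S) (ξ : GromovBoundary S) (M : ℝ) : Set (GromovBoundary S) :=
  {η | ∀ x y : SeqAtInfinity S, Quot.mk _ x = ξ → Quot.mk _ y = η →
    ∀ᶠ N in atTop, ∀ i ≥ N, ∀ j ≥ N, M ≤ gromovProduct (x.1 i) (y.1 j) o}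

theorem basicNhd_anti (o : S) (ξ : GromovBoundary S) : Antitone (basicNhd o ξ) :=
  fun _ _ hM _ hη x y hx hy => (hη x y hx hy).mono fun _ h i hi j hj => hM.trans (h i hi j hj)

theorem mk_mem_basicNhd_mk (hδ : IsGromovHyperbolic S δ) {x y : SeqAtInfinity S}
    (h : ∀ᶠ N in atTop, ∀ i ≥ N, ∀ j ≥ N, M + 2 * δ ≤ gromovProduct (x.1 i) (y.1 j) o) :
    Quot.mk _ y ∈ basicNhd o (Quot.mk _ x) M := by
  intro x' y' hx hy
  filter_upwards [h, (asymptoticAtInfinity_iff o).1 ((mk_eq_mk_iff hδ).1 hx) (M + 2 * δ),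
    (asymptoticAtInfinity_iff o).1 ((mk_eq_mk_iff hδ).1 hy.symm) (M + δ)]
    with N hxy hxx' hyy' i hi j hj
  refine hδ.le_gromovProduct (y := y.1 N) (hδ.le_gromovProduct (y := x.1 N) ?_ ?_)
    (hyy' N le_rfl j hj)
  · linarith [hxx' i hi N le_rfl]
  · linarith [hxy N le_rfl N le_rfl]

theorem mem_basicNhd_self (hδ : IsGromovHyperbolic S δ) (o : S) (ξ : GromovBoundary S) (M : ℝ) :
    ξ ∈ basicNhd o ξ M := by
  obtain ⟨x, rfl⟩ := Quot.exists_rep ξ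
  exact mk_mem_basicNhd_mk hδ ((asymptoticAtInfinity_iff o).1 x.2 _)

theorem exists_disjoint_basicNhd (hδ : IsGromovHyperbolic S δ) (o : S) (hne : ξ ≠ η) :
    ∃ M : ℝ, Disjoint (basicNhd o ξ M) (basicNhd o η M) := by
  obtain ⟨B, hB⟩ := exists_gromovProduct_le_of_ne hδ o hne
  obtain ⟨x, rfl⟩ := Quot.exists_rep ξ
  obtain ⟨y, rfl⟩ := Quot.exists_rep η
  refine ⟨B + 1 + δ, Set.disjoint_left.2 fun ζ hξζ hηζ => ?_⟩
  obtain ⟨z, rfl⟩ := Quot.exists_rep ζ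
  obtain ⟨N, hxy, hxz, hyz⟩ :=
    ((hB x y rfl rfl).and ((hξζ x z rfl rfl).and (hηζ y z rfl rfl))).exists
  have hge : B + 1 ≤ gromovProduct (x.1 N) (y.1 N) o :=
    hδ.le_gromovProduct (hxz N le_rfl N le_rfl)
      (gromovProduct_comm (z.1 N) _ _ ▸ hyz N le_rfl N le_rfl)
  linarith [hxy N le_rfl N le_rfl]

theorem eventually_notMem_basicNhd (hδ : IsGromovHyperbolic S δ) (o : S) (hne : ξ ≠ η) :
    ∀ᶠ M in atTop, η ∉ basicNhd o ξ M := by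
  obtain ⟨M₀, hM₀⟩ := exists_disjoint_basicNhd hδ o hne
  filter_upwards [eventually_ge_atTop M₀] with M hM hη
  exact Set.disjoint_left.1 hM₀ (basicNhd_anti o ξ hM hη) (mem_basicNhd_self hδ o η M₀)

theorem smul_mem_basicNhd {G : Type u} [Group G] [MulAction G S] [IsIsometricSMul G S]
    (hη : η ∈ basicNhd o ξ M) (k : G) :
    k • η ∈ basicNhd o (k • ξ) (M - dist (k • o) o) := by
  intro x y hx hy
  have hsmul := hη ⟨fun n => k⁻¹ • x.1 n, x.2.smul k⁻¹⟩ ⟨fun n => k⁻¹ • y.1 n, y.2.smul k⁻¹⟩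
    (inv_smul_eq_iff (α := GromovBoundary S).2 hx) (inv_smul_eq_iff (α := GromovBoundary S).2 hy)
  filter_upwards [hsmul] with N hN i hi j hj
  have hbase := gromovProduct_le_add_dist_base (x.1 i) (y.1 j) (k • o) o
  have hxy := hN i hi j hj
  rw [gromovProduct_smul_smul, inv_inv] at hxy
  linarith

/-- The boundary points all of whose basic neighbourhoods meet `A`, a notion of closure that avoids
putting a topology on the Gromov boundary. -/
def gromovClosure (o : S) (A : Set (GromovBoundary S)) : Set (GromovBoundary S) :=
  {ξ | ∀ M : ℝ, (basicNhd o ξ M ∩ A).Nonempty}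

theorem gromovClosure_mono (o : S) {A B : Set (GromovBoundary S)} (h : A ⊆ B) :
    gromovClosure o A ⊆ gromovClosure o B :=
  fun _ hξ M => (hξ M).mono (Set.inter_subset_inter_right _ h)

theorem gromovClosure_subset_of_finite (hδ : IsGromovHyperbolic S δ) (o : S)
    {A : Set (GromovBoundary S)} (hA : A.Finite) : gromovClosure o A ⊆ A := by
  intro ξ hξ
  by_contra hξA
  have hfar : ∀ᶠ M in atTop, ∀ η ∈ A, η ∉ basicNhd o ξ M :=
    (eventually_all_finite hA).2 fun η hη =>
      eventually_notMem_basicNhd hδ o fun h => hξA (h ▸ hη)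
  obtain ⟨M, hM⟩ := hfar.exists
  obtain ⟨η, hη, hηA⟩ := hξ M
  exact hM η hηA hη

end GromovBoundary

end BoundaryNeighbourhoods

section LimitSets

variable {G : Type u} [Group G] {S : Type v} [MetricSpace S] [MulAction G S] {δ : ℝ} {o : S}

theorem limitSet_subgroup_subset (H : Subgroup G) : limitSet H S ⊆ limitSet G S := by
  rintro ξ ⟨s, x, hx, rfl⟩
  refine ⟨s, x, fun n => ?_, rfl⟩
  obtain ⟨h, hh⟩ := hx n
  exact ⟨h.1, hh⟩

theorem mk_mem_limitSet_of_le_gromovProduct (hδ : IsGromovHyperbolic S δ) {x : SeqAtInfinity S}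
    (h : ∀ M : ℝ, ∃ a : G, ∀ᶠ j in atTop, M ≤ gromovProduct (a • o) (x.1 j) o) :
    (Quot.mk _ x : GromovBoundary S) ∈ limitSet G S := by
  choose a ha using fun n : ℕ => h n
  have hax : AsymptoticAtInfinity (fun n => a n • o) x.1 := by
    rw [asymptoticAtInfinity_iff o]
    intro M
    filter_upwards [(asymptoticAtInfinity_iff o).1 x.2 (M + δ),
      tendsto_natCast_atTop_atTop.eventually_ge_atTop (M + δ)] with N hx hN i hi j hj
    obtain ⟨m, hm, hNm⟩ := ((ha i).and (eventually_ge_atTop N)).exists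
    have hNi : (N : ℝ) ≤ i := Nat.cast_le.2 hi
    exact hδ.le_gromovProduct (by linarith) (hx m hNm j hj)
  exact ⟨o, ⟨_, hax.trans hδ hax.symm⟩, fun n => ⟨a n, rfl⟩, Quot.sound hax⟩

theorem gromovClosure_limitSet_subset [IsIsometricSMul G S] (hδ : IsGromovHyperbolic S δ) (o : S) :
    GromovBoundary.gromovClosure o (limitSet G S) ⊆ limitSet G S := by
  intro ξ hξ
  obtain ⟨x, rfl⟩ := Quot.exists_rep ξ
  refine mk_mem_limitSet_of_le_gromovProduct (o := o) hδ fun M => ?_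
  obtain ⟨η, hη, hηlim⟩ := hξ M
  obtain ⟨a, ha, rfl⟩ := (mem_limitSet_iff o).1 hηlim
  obtain ⟨N, hN⟩ := (hη x _ rfl rfl).exists
  refine ⟨a N, ?_⟩
  filter_upwards [eventually_ge_atTop N] with j hj
  rw [gromovProduct_comm]
  exact hN j hj N le_rfl

end LimitSets

section Dynamics

variable {G : Type u} [Group G] {S : Type v} [MetricSpace S] [MulAction G S] [IsIsometricSMul G S]
  {δ : ℝ} {o : S} {g k : G} {ξ : GromovBoundary S}

theorem exists_commute_pow_of_finite_range_conj
    (h : (Set.range fun n : ℕ => (g ^ n)⁻¹ * k * g ^ n).Finite) :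
    ∃ p : ℕ, 0 < p ∧ Commute k (g ^ p) := by
  obtain ⟨m, n, hmn, hconj⟩ := h.exists_lt_map_eq_of_forall_mem fun n => Set.mem_range_self n
  obtain ⟨p, rfl⟩ := Nat.exists_eq_add_of_le hmn.le
  refine ⟨p, by lia, ?_⟩
  have hk : k = (g ^ p)⁻¹ * k * g ^ p := by
    refine mul_left_cancel (a := (g ^ m)⁻¹) (mul_right_cancel (b := g ^ m) (hconj.trans ?_))
    simp only [add_comm m, pow_add, mul_inv_rev, mul_assoc]
  rw [mul_assoc, eq_inv_mul_iff_mul_eq] at hk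
  exact hk.symm

namespace IsLoxodromicAt

theorem eventually_le_gromovProduct_conj_smul (hδ : IsGromovHyperbolic S δ)
    (h : IsLoxodromicAt o g) (hk : k • h.attracting ≠ h.attracting) (M : ℝ) :
    ∀ᶠ n in atTop, ∀ j ≥ n,
      M ≤ gromovProduct (((g ^ n)⁻¹ * k * g ^ n) • o) (g⁻¹ ^ j • o) o := by
  obtain ⟨B, hB⟩ := GromovBoundary.exists_gromovProduct_le_of_ne hδ o hk.symm
  obtain ⟨A, hA⟩ := h.inv.exists_gromovProduct_le
  filter_upwards [hB _ _ rfl rfl, h.tendsto_dist.eventually_ge_atTop (M + δ + B),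
    h.tendsto_dist.eventually_ge_atTop (M + δ + A)] with n hBn hdB hdA j hj
  have hback : gromovProduct (g ^ n • o) (k • g ^ n • o) o ≤ B := hBn n le_rfl n le_rfl
  have hsum := gromovProduct_smul_add_gromovProduct_inv_smul (g ^ n)⁻¹ (k • g ^ n • o) o
  rw [inv_inv, dist_inv_smul_self] at hsum
  have hray := dist_sub_le_gromovProduct hA hj
  rw [inv_pow g n, dist_inv_smul_self, gromovProduct_comm] at hray
  refine hδ.le_gromovProduct (y := (g ^ n)⁻¹ • o) ?_ (by linarith)
  rw [mul_smul, mul_smul]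
  linarith

theorem dist_pow_smul_le (hδ : IsGromovHyperbolic S δ) (h : IsLoxodromicAt o g) {A : ℝ}
    (hA : ∀ m n : ℕ, gromovProduct (g ^ m • o) (g⁻¹ ^ n • o) o ≤ A)
    (hk : k • h.attracting = h.attracting) (n : ℕ) :
    dist (g ^ n • o) (k • g ^ n • o) ≤ 3 * dist (k • o) o + 2 * A + 4 * δ := by
  obtain ⟨N, hN, hnN⟩ := (((asymptoticAtInfinity_iff o).1
    ((GromovBoundary.mk_eq_mk_iff hδ).1 hk) (dist (g ^ n • o) o - A + δ)).and
      (eventually_ge_atTop n)).exists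
  have hfar : dist (g ^ n • o) o - A + δ ≤ gromovProduct (k • g ^ N • o) (g ^ N • o) o :=
    hN N le_rfl N le_rfl
  have hray := dist_sub_le_gromovProduct hA hnN
  have hkray := gromovProduct_le_add_dist_base (k • g ^ N • o) (k • g ^ n • o) (k • o) o
  rw [gromovProduct_smul] at hkray
  have hclose : dist (g ^ n • o) o - dist (k • o) o - A - 2 * δ ≤
      gromovProduct (k • g ^ n • o) (g ^ n • o) o := by
    have hdist := dist_nonneg (x := k • o) (y := o)
    refine hδ.le_gromovProduct (y := g ^ N • o)
      (hδ.le_gromovProduct (y := k • g ^ N • o) ?_ ?_) (by linarith [hδ.nonneg o])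
    · rw [gromovProduct_comm]
      linarith
    · linarith [hδ.nonneg o]
  have htri := dist_triangle (k • g ^ n • o) (k • o) o
  rw [dist_smul] at htri
  rw [gromovProduct, dist_comm (k • g ^ n • o) (g ^ n • o)] at hclose
  linarith

-- The conjugates `g⁻ⁿ k gⁿ` displace all points `gⁱ o` by a bounded amount.
theorem exists_commute_pow (hδ : IsGromovHyperbolic S δ) (hacyl : IsAcylindricalAction G S)
    (h : IsLoxodromicAt o g) (hk : k • h.attracting = h.attracting) :
    ∃ p : ℕ, 0 < p ∧ Commute k (g ^ p) := by
  obtain ⟨A, hA⟩ := h.exists_gromovProduct_le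
  have hdisp : ∀ n i : ℕ, dist (g ^ i • o) (((g ^ n)⁻¹ * k * g ^ n) • g ^ i • o) ≤
      |3 * dist (k • o) o + 2 * A + 4 * δ| + 1 := fun n i => by
    rw [mul_smul, mul_smul, ← dist_smul_left_eq_dist_inv_smul, ← mul_smul, ← pow_add]
    linarith [h.dist_pow_smul_le hδ hA hk (n + i), le_abs_self (3 * dist (k • o) o + 2 * A + 4 * δ)]
  obtain ⟨R, N, -, -, hRN⟩ := hacyl (|3 * dist (k • o) o + 2 * A + 4 * δ| + 1) (by positivity)
  obtain ⟨m, hm⟩ := (h.tendsto_dist.eventually_ge_atTop R).exists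
  refine exists_commute_pow_of_finite_range_conj ((Set.finite_of_encard_le_coe
    (hRN o (g ^ m • o) (dist_comm o _ ▸ hm))).subset (Set.range_subset_iff.2 fun n => ?_))
  exact ⟨by simpa only [pow_zero, one_smul] using hdisp n 0, hdisp n m⟩

theorem smul_inv_attracting (hδ : IsGromovHyperbolic S δ) (hacyl : IsAcylindricalAction G S)
    (h : IsLoxodromicAt o g) (hk : k • h.attracting = h.attracting) :
    k • h.inv.attracting = h.inv.attracting := by
  obtain ⟨p, hp, hcomm⟩ := h.exists_commute_pow hδ hacyl hk
  have hconj : k * g⁻¹ ^ p * k⁻¹ = g⁻¹ ^ p := by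
    rw [inv_pow, hcomm.inv_right.eq, mul_inv_cancel_right]
  rw [← h.inv.attracting_pow hp, smul_attracting]
  exact attracting_congr _ _ hconj

theorem inv_inv_attracting (h : IsLoxodromicAt o g) : h.inv.inv.attracting = h.attracting :=
  attracting_congr _ _ (inv_inv g)

theorem eventually_pow_smul_mem_basicNhd (hδ : IsGromovHyperbolic S δ) (h : IsLoxodromicAt o g)
    (hξ : ξ ≠ h.inv.attracting) (M : ℝ) :
    ∀ᶠ n in atTop, g ^ n • ξ ∈ GromovBoundary.basicNhd o h.attracting M := by
  obtain ⟨A, hA⟩ := h.exists_gromovProduct_le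
  obtain ⟨B, hB⟩ := GromovBoundary.exists_gromovProduct_le_of_ne hδ o hξ.symm
  obtain ⟨y, rfl⟩ := Quot.exists_rep ξ
  obtain ⟨N, hN⟩ := (hB _ y rfl rfl).exists
  filter_upwards [eventually_ge_atTop N, h.tendsto_dist.eventually_ge_atTop (M + 3 * δ + A),
    h.tendsto_dist.eventually_ge_atTop (M + 3 * δ + B)] with n hn hdA hdB
  refine GromovBoundary.mk_mem_basicNhd_mk hδ ?_
  filter_upwards [eventually_ge_atTop n] with K hK i hi j hj
  have hray := dist_sub_le_gromovProduct hA (hK.trans hi)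
  have hback : gromovProduct (g⁻¹ ^ n • o) (y.1 j) o ≤ B :=
    hN n hn j (hn.trans (hK.trans hj))
  have hsum := gromovProduct_smul_add_gromovProduct_inv_smul (g ^ n) (y.1 j) o
  rw [← inv_pow] at hsum
  refine hδ.le_gromovProduct (y := g ^ n • o) (by linarith) ?_
  rw [gromovProduct_comm]
  linarith

theorem eventually_smul_pow_smul_ne (hδ : IsGromovHyperbolic S δ) (h : IsLoxodromicAt o g)
    (hξ : ξ ≠ h.inv.attracting) (hk : k • h.attracting ≠ h.attracting) :
    ∀ᶠ n : ℕ in atTop, k • g ^ n • ξ ≠ g ^ n • ξ := by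
  obtain ⟨M, hM⟩ := GromovBoundary.exists_disjoint_basicNhd hδ o hk
  have hdist := dist_nonneg (x := k • o) (y := o)
  filter_upwards [h.eventually_pow_smul_mem_basicNhd hδ hξ (M + dist (k • o) o)] with n hn heq
  refine Set.disjoint_left.1 hM ?_ (GromovBoundary.basicNhd_anti o _ (by linarith) hn)
  simpa only [add_sub_cancel_right, heq] using GromovBoundary.smul_mem_basicNhd hn k

end IsLoxodromicAt

variable (G) in
/-- The endpoints at infinity of the loxodromic elements of `G`. It suffices to collect the
attracting points, since the inverse of a loxodromic element is loxodromic. -/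
def loxodromicPoints (o : S) : Set (GromovBoundary S) :=
  {ξ | ∃ (g : G) (h : IsLoxodromicAt o g), h.attracting = ξ}

theorem smul_mem_loxodromicPoints (hξ : ξ ∈ loxodromicPoints G o) (a : G) :
    a • ξ ∈ loxodromicPoints G o := by
  obtain ⟨g, h, rfl⟩ := hξ
  exact ⟨_, h.conj a, (h.smul_attracting a).symm⟩

/-- For every `g`, conjugation by the powers of `g` carries each element of `H` back into `H`
infinitely often. This is what Poincaré recurrence gives for invariant random subgroups. -/
def IsConjRecurrent (H : Subgroup G) : Prop :=
  ∀ h ∈ H, ∀ g : G, ∃ᶠ n : ℕ in atTop, (g ^ n)⁻¹ * h * g ^ n ∈ H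

theorem IsConjRecurrent.le_fixingSubgroup_loxodromicPoints (hδ : IsGromovHyperbolic S δ) (o : S)
    (hacyl : IsAcylindricalAction G S) {H : Subgroup G} (hH : IsConjRecurrent H)
    (hξ : ∀ h ∈ H, h • ξ = ξ) : H ≤ fixingSubgroup G (loxodromicPoints G o) := by
  intro k hk
  rw [mem_fixingSubgroup_iff]
  rintro _ ⟨g, hg, rfl⟩
  by_contra hmove
  have hξg : ξ ≠ hg.inv.attracting := fun h =>
    hmove (hg.inv_inv_attracting ▸ hg.inv.smul_inv_attracting hδ hacyl (h ▸ hξ k hk))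
  obtain ⟨n, hn, hne⟩ :=
    ((hH k hk g).and_eventually (hg.eventually_smul_pow_smul_ne hδ hξg hmove)).exists
  have hfix := hξ _ hn
  rw [mul_smul, mul_smul, inv_smul_eq_iff] at hfix
  exact hne hfix

end Dynamics

section LimitSetDensity

variable {G : Type u} [Group G] {S : Type v} [MetricSpace S] [MulAction G S] [IsIsometricSMul G S]
  {δ : ℝ} {o : S} {g : G}

-- The half-orbits of `g` and `g⁻¹` diverge, so no point is in the direction of both.
theorem IsLoxodromicAt.exists_forall_gromovProduct_le (hδ : IsGromovHyperbolic S δ)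
    (h : IsLoxodromicAt o g) :
    ∃ B : ℝ, ∀ p : S, ∃ g' : G, IsLoxodromicAt o g' ∧
      ∀ j : ℕ, gromovProduct p (g' ^ j • o) o ≤ B := by
  obtain ⟨A, hA⟩ := h.exists_gromovProduct_le
  refine ⟨A + δ, fun p => ?_⟩
  by_cases hp : ∀ j : ℕ, gromovProduct p (g ^ j • o) o ≤ A + δ
  · exact ⟨g, h, hp⟩
  · push Not at hp
    obtain ⟨i, hi⟩ := hp
    refine ⟨g⁻¹, h.inv, fun j => ?_⟩
    rw [gromovProduct_comm]
    exact hδ.gromovProduct_le_of_lt (gromovProduct_comm (g ^ i • o) _ _ ▸ hA i j) hi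

theorem limitSet_subset_gromovClosure_loxodromicPoints (hδ : IsGromovHyperbolic S δ)
    (hg : IsLoxodromicAt o g) :
    limitSet G S ⊆ GromovBoundary.gromovClosure o (loxodromicPoints G o) := by
  intro ξ hξ M
  obtain ⟨B, hB⟩ := hg.exists_forall_gromovProduct_le hδ
  obtain ⟨a, ha, rfl⟩ := (mem_limitSet_iff o).1 hξ
  obtain ⟨n, hn, hn'⟩ := (((asymptoticAtInfinity_iff o).1 ha (M + 3 * δ)).and
    ((asymptoticAtInfinity_iff o).1 ha (M + 3 * δ + B))).exists
  obtain ⟨g', hg', hle⟩ := hB ((a n)⁻¹ • o)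
  refine ⟨a n • hg'.attracting, GromovBoundary.mk_mem_basicNhd_mk hδ ?_,
    smul_mem_loxodromicPoints ⟨g', hg', rfl⟩ (a n)⟩
  filter_upwards [eventually_ge_atTop n] with N hN i hi j _
  have hlarge := hn' n le_rfl n le_rfl
  rw [gromovProduct_self] at hlarge
  have hsum := gromovProduct_smul_add_gromovProduct_inv_smul (a n) (g' ^ j • o) o
  refine hδ.le_gromovProduct (y := a n • o) (by linarith [hn i (hN.trans hi) n le_rfl]) ?_
  rw [gromovProduct_comm]
  linarith [hle j]

theorem infinite_loxodromicPoints (hδ : IsGromovHyperbolic S δ) (o : S)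
    (hne : IsNonelementaryAction G S) : (loxodromicPoints G o).Infinite := by
  obtain ⟨g, hg⟩ := exists_isLoxodromicAt hδ o hne.nontrivial
  exact fun hfin => hne (hfin.subset
    ((limitSet_subset_gromovClosure_loxodromicPoints hδ hg).trans
      (GromovBoundary.gromovClosure_subset_of_finite hδ o hfin)))

end LimitSetDensity

section FixedPoints

variable {S : Type v} [MetricSpace S] {δ : ℝ}

-- At `x` at least two of `p`, `q`, `r` have a small Gromov product with `y`, and vice versa, so one
-- of them has both.
theorem dist_le_of_gromovProduct_le (hδ : IsGromovHyperbolic S δ) {A : ℝ} {x y p q r : S}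
    (hpqx : gromovProduct p q x ≤ A) (hqrx : gromovProduct q r x ≤ A)
    (hprx : gromovProduct p r x ≤ A) (hpqy : gromovProduct p q y ≤ A)
    (hqry : gromovProduct q r y ≤ A) (hpry : gromovProduct p r y ≤ A) :
    dist x y ≤ 2 * A + 2 * δ := by
  have small : ∀ {a b o : S}, gromovProduct a b o ≤ A → ∀ z : S,
      gromovProduct a z o ≤ A + δ ∨ gromovProduct b z o ≤ A + δ := fun {a b o} hab z => by
    rw [gromovProduct_comm b, ← min_le_iff]
    linarith [hδ a z b o]
  obtain ⟨v, hvx, hvy⟩ : ∃ v : S, gromovProduct v y x ≤ A + δ ∧ gromovProduct v x y ≤ A + δ := by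
    have := small hpqx y
    have := small hqrx y
    have := small hprx y
    have := small hpqy x
    have := small hqry x
    have := small hpry x
    grind
  have hsum := gromovProduct_add_swap v y x
  rw [gromovProduct_comm x, dist_comm] at hsum
  linarith [gromovProduct_add_swap v y x, dist_comm x y]

variable {G : Type u} [Group G] [MulAction G S] [IsIsometricSMul G S]

theorem exists_eventually_gromovProduct_smul_base_le (hδ : IsGromovHyperbolic S δ) (o : S)
    {ξ η : GromovBoundary S} (hne : ξ ≠ η) :
    ∃ B : ℝ, ∀ x y : SeqAtInfinity S, Quot.mk _ x = ξ → Quot.mk _ y = η →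
      ∀ k : G, k • ξ = ξ → k • η = η →
        ∀ᶠ n in atTop, gromovProduct (x.1 n) (y.1 n) (k • o) ≤ B := by
  obtain ⟨B, hB⟩ := GromovBoundary.exists_gromovProduct_le_of_ne hδ o hne
  refine ⟨B, ?_⟩
  rintro x y rfl rfl k hx hy
  filter_upwards [hB ⟨_, x.2.smul k⁻¹⟩ ⟨_, y.2.smul k⁻¹⟩
    (inv_smul_eq_iff (α := GromovBoundary S).2 hx.symm)
    (inv_smul_eq_iff (α := GromovBoundary S).2 hy.symm)] with n hn
  rw [← inv_inv k, ← gromovProduct_smul_smul]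
  exact hn n le_rfl n le_rfl

theorem exists_dist_smul_le_of_mem_fixingSubgroup (hδ : IsGromovHyperbolic S δ) (o : S)
    {ξ η ζ : GromovBoundary S} (hξη : ξ ≠ η) (hξζ : ξ ≠ ζ) (hηζ : η ≠ ζ) :
    ∃ C : ℝ, ∀ k ∈ fixingSubgroup G {ξ, η, ζ}, dist o (k • o) ≤ C := by
  obtain ⟨B₁, h₁⟩ := exists_eventually_gromovProduct_smul_base_le (G := G) hδ o hξη
  obtain ⟨B₂, h₂⟩ := exists_eventually_gromovProduct_smul_base_le (G := G) hδ o hξζ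
  obtain ⟨B₃, h₃⟩ := exists_eventually_gromovProduct_smul_base_le (G := G) hδ o hηζ
  obtain ⟨p, hp⟩ := Quot.exists_rep ξ
  obtain ⟨q, hq⟩ := Quot.exists_rep η
  obtain ⟨r, hr⟩ := Quot.exists_rep ζ
  obtain ⟨B, hB⟩ := Finset.exists_le ({B₁, B₂, B₃} : Finset ℝ)
  have small : ∀ k ∈ fixingSubgroup G {ξ, η, ζ}, ∀ᶠ n in atTop,
      gromovProduct (p.1 n) (q.1 n) (k • o) ≤ B ∧ gromovProduct (q.1 n) (r.1 n) (k • o) ≤ B ∧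
        gromovProduct (p.1 n) (r.1 n) (k • o) ≤ B := fun k hk => by
    rw [mem_fixingSubgroup_iff] at hk
    have hkξ := hk ξ (by simp)
    have hkη := hk η (by simp)
    have hkζ := hk ζ (by simp)
    filter_upwards [h₁ p q hp hq k hkξ hkη, h₂ p r hp hr k hkξ hkζ, h₃ q r hq hr k hkη hkζ]
      with n hpq hpr hqr
    exact ⟨hpq.trans (hB _ (by simp)), hqr.trans (hB _ (by simp)), hpr.trans (hB _ (by simp))⟩
  refine ⟨2 * B + 2 * δ, fun k hk => ?_⟩
  obtain ⟨n, ⟨hpq, hqr, hpr⟩, hpqk, hqrk, hprk⟩ := ((small 1 (one_mem _)).and (small k hk)).exists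
  rw [one_smul] at hpq hqr hpr
  exact dist_le_of_gromovProduct_le hδ hpq hqr hpr hpqk hqrk hprk

end FixedPoints

section FiniteRadical

variable {G : Type u} [Group G] {S : Type v} [MetricSpace S] [MulAction G S] {δ : ℝ} {o : S}

theorem IsAcylindricalAction.subgroup (hacyl : IsAcylindricalAction G S) (H : Subgroup G) :
    IsAcylindricalAction H S := by
  intro ε hε
  obtain ⟨R, N, hR, hN, hRN⟩ := hacyl ε hε
  refine ⟨R, N, hR, hN, fun x y hxy => le_trans ?_ (hRN x y hxy)⟩
  exact Set.encard_le_encard_of_injOn (f := Subtype.val) (fun _ hh => hh)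
    Subtype.val_injective.injOn

variable [IsIsometricSMul G S]

theorem isIsometricSMul_subgroup (H : Subgroup G) : IsIsometricSMul H S :=
  ⟨fun h => isometry_smul S (h : G)⟩

-- By normality the elements of `K` also displace the far away point `g • o` by at most `C`.
theorem IsAcylindricalAction.finite_of_normal_of_dist_le (hacyl : IsAcylindricalAction G S)
    {K : Subgroup G} [K.Normal] {C : ℝ} (hC : ∀ k ∈ K, dist o (k • o) ≤ C)
    (hunbounded : ∀ R : ℝ, ∃ g : G, R ≤ dist (g • o) o) : Finite K := by
  obtain ⟨R, N, -, -, hRN⟩ := hacyl (max C 1) (by positivity)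
  obtain ⟨g, hg⟩ := hunbounded R
  refine ((Set.finite_of_encard_le_coe (hRN o (g • o) (dist_comm o _ ▸ hg))).subset
    fun k hk => ⟨(hC k hk).trans (le_max_left C 1), ?_⟩).to_subtype
  have hconj := hC _ (‹K.Normal›.conj_mem k hk g⁻¹)
  rw [inv_inv, mul_smul, mul_smul, ← dist_smul_left_eq_dist_inv_smul] at hconj
  exact hconj.trans (le_max_left C 1)

theorem normal_fixingSubgroup_loxodromicPoints :
    (fixingSubgroup G (loxodromicPoints G o)).Normal := by
  refine ⟨fun k hk g => ?_⟩
  rw [mem_fixingSubgroup_iff] at hk ⊢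
  intro ξ hξ
  rw [mul_smul, mul_smul, hk _ (smul_mem_loxodromicPoints hξ g⁻¹), smul_inv_smul]

theorem finite_fixingSubgroup_loxodromicPoints (hδ : IsGromovHyperbolic S δ) (o : S)
    (hne : IsNonelementaryAction G S) (hacyl : IsAcylindricalAction G S) :
    Finite (fixingSubgroup G (loxodromicPoints G o)) := by
  classical
  obtain ⟨T, hT, hcard⟩ := (infinite_loxodromicPoints hδ o hne).exists_subset_card_eq 3
  obtain ⟨ξ, η, ζ, hξη, hξζ, hηζ, rfl⟩ := Finset.card_eq_three.1 hcard
  simp only [Finset.coe_insert, Finset.coe_singleton] at hT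
  obtain ⟨C, hC⟩ := exists_dist_smul_le_of_mem_fixingSubgroup (G := G) hδ o hξη hξζ hηζ
  obtain ⟨g, hg⟩ := exists_isLoxodromicAt hδ o hne.nontrivial
  have := normal_fixingSubgroup_loxodromicPoints (G := G) (o := o)
  exact hacyl.finite_of_normal_of_dist_le
    (fun k hk => hC k (fixingSubgroup_antitone G (GromovBoundary S) hT hk))
    fun R => (hg.tendsto_dist.eventually_ge_atTop R).exists.imp' (g ^ ·) fun _ => id

theorem le_fixingSubgroup_loxodromicPoints_of_finite (hδ : IsGromovHyperbolic S δ) (o : S)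
    (N : Subgroup G) [N.Normal] [Finite N] : N ≤ fixingSubgroup G (loxodromicPoints G o) := by
  intro k hk
  rw [mem_fixingSubgroup_iff]
  rintro _ ⟨g, hg, rfl⟩
  by_contra hmove
  obtain ⟨M, hM⟩ := (Set.finite_range fun k : N => dist ((k : G) • o) o).bddAbove
  obtain ⟨n, hn⟩ := (hg.eventually_le_gromovProduct_conj_smul hδ hmove (M + 1)).exists
  have hconj := ‹N.Normal›.conj_mem k hk (g ^ n)⁻¹
  rw [inv_inv] at hconj
  have hle : dist (((g ^ n)⁻¹ * k * g ^ n) • o) o ≤ M := hM ⟨⟨_, hconj⟩, rfl⟩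
  linarith [hn n le_rfl,
    gromovProduct_le_dist_left (((g ^ n)⁻¹ * k * g ^ n) • o) (g⁻¹ ^ n • o) o]

theorem isGreatest_fixingSubgroup_loxodromicPoints (hδ : IsGromovHyperbolic S δ) (o : S)
    (hne : IsNonelementaryAction G S) (hacyl : IsAcylindricalAction G S) :
    IsGreatest {N : Subgroup G | N.Normal ∧ Finite N}
      (fixingSubgroup G (loxodromicPoints G o)) :=
  ⟨⟨normal_fixingSubgroup_loxodromicPoints,
    finite_fixingSubgroup_loxodromicPoints hδ o hne hacyl⟩,
    fun N ⟨_, _⟩ => le_fixingSubgroup_loxodromicPoints_of_finite hδ o N⟩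

theorem finiteRadical_eq_fixingSubgroup_loxodromicPoints (hδ : IsGromovHyperbolic S δ) (o : S)
    (hne : IsNonelementaryAction G S) (hacyl : IsAcylindricalAction G S) :
    finiteRadical G = fixingSubgroup G (loxodromicPoints G o) :=
  (isGreatest_fixingSubgroup_loxodromicPoints hδ o hne hacyl).isLUB.sSup_eq

end FiniteRadical

section GeometricDensity

variable {G : Type u} [Group G] {S : Type v} [MetricSpace S] [MulAction G S] [IsIsometricSMul G S]
  {δ : ℝ} {H : Subgroup G}

theorem IsConjRecurrent.loxodromicPoints_subset_limitSet (hδ : IsGromovHyperbolic S δ) (o : S)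
    (hH : IsConjRecurrent H) (hfix : ¬ ∃ ξ : GromovBoundary S, ∀ h ∈ H, h • ξ = ξ) :
    loxodromicPoints G o ⊆ limitSet H S := by
  rintro _ ⟨g, hg, rfl⟩
  push Not at hfix
  obtain ⟨k, hk, hmove⟩ := hfix hg.inv.attracting
  refine mk_mem_limitSet_of_le_gromovProduct (o := o) hδ fun M => ?_
  obtain ⟨n, hn, hle⟩ := ((hH k hk g⁻¹).and_eventually
    (hg.inv.eventually_le_gromovProduct_conj_smul hδ hmove M)).exists
  refine ⟨⟨_, hn⟩, ?_⟩
  filter_upwards [eventually_ge_atTop n] with j hj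
  simpa only [inv_inv, Subgroup.mk_smul] using hle j hj

theorem IsConjRecurrent.isGeometricallyDense (hδ : IsGromovHyperbolic S δ) (o : S)
    (hne : IsNonelementaryAction G S) (hacyl : IsAcylindricalAction G S) (hH : IsConjRecurrent H)
    (hHK : ¬ H ≤ fixingSubgroup G (loxodromicPoints G o)) : IsGeometricallyDense H S := by
  have hfix : ¬ ∃ ξ : GromovBoundary S, ∀ h ∈ H, h • ξ = ξ := fun ⟨ξ, hξ⟩ =>
    hHK (hH.le_fixingSubgroup_loxodromicPoints hδ o hacyl hξ)
  have := isIsometricSMul_subgroup (S := S) H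
  obtain ⟨g, hg⟩ := exists_isLoxodromicAt hδ o hne.nontrivial
  refine ⟨hfix, (limitSet_subgroup_subset H).antisymm ?_⟩
  calc limitSet G S
      ⊆ GromovBoundary.gromovClosure o (loxodromicPoints G o) :=
        limitSet_subset_gromovClosure_loxodromicPoints hδ hg
    _ ⊆ GromovBoundary.gromovClosure o (limitSet H S) :=
        GromovBoundary.gromovClosure_mono o (hH.loxodromicPoints_subset_limitSet hδ o hfix)
    _ ⊆ limitSet H S := gromovClosure_limitSet_subset hδ o

theorem IsConjRecurrent.isTotallyGeometricallyDense (hH : IsConjRecurrent H)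
    (hHK : ¬ H ≤ finiteRadical G) : IsTotallyGeometricallyDense.{u, w} H := by
  intro S _ _ _ hS hne hacyl
  obtain ⟨δ, hδ⟩ := hS.exists_isGromovHyperbolic
  obtain ⟨_, o, -⟩ := hne.nonempty
  refine hH.isGeometricallyDense hδ o hne hacyl ?_
  rwa [← finiteRadical_eq_fixingSubgroup_loxodromicPoints hδ o hne hacyl]

theorem IsAcylindricallyHyperbolic.isGreatest_finiteRadical
    (hG : IsAcylindricallyHyperbolic.{u, v} G) :
    IsGreatest {N : Subgroup G | N.Normal ∧ Finite N} (finiteRadical G) := by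
  obtain ⟨S, _, _, _, hS, hne, hacyl⟩ := hG
  obtain ⟨δ, hδ⟩ := hS.exists_isGromovHyperbolic
  obtain ⟨_, o, -⟩ := hne.nonempty
  rw [finiteRadical_eq_fixingSubgroup_loxodromicPoints hδ o hne hacyl]
  exact isGreatest_fixingSubgroup_loxodromicPoints hδ o hne hacyl

theorem IsTotallyGeometricallyDense.isAcylindricallyHyperbolic
    (hG : IsAcylindricallyHyperbolic.{u, v} G) (hH : IsTotallyGeometricallyDense.{u, v} H) :
    IsAcylindricallyHyperbolic.{u, v} H := by
  obtain ⟨S, _, _, _, hS, hne, hacyl⟩ := hG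
  have hneH : IsNonelementaryAction H S := by
    rwa [IsNonelementaryAction, (hH S hS hne hacyl).2]
  exact ⟨S, inferInstance, inferInstance, isIsometricSMul_subgroup H, hS, hneH, hacyl.subgroup H⟩

end GeometricDensity

section InvariantRandomSubgroups

variable {G : Type u} [Group G]

theorem continuous_subgroup_iff {X : Type*} [TopologicalSpace X] {f : X → Subgroup G} :
    Continuous f ↔ ∀ g : G, IsClopen {x | g ∈ f x} := by
  classical
  rw [continuous_induced_rng, continuous_pi_iff]
  refine forall_congr' fun g => (continuous_bool_rng true).trans ?_
  congr! 1
  ext x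
  simp

theorem isClopen_setOf_mem_subgroup (g : G) : IsClopen {H : Subgroup G | g ∈ H} :=
  continuous_subgroup_iff.1 continuous_id g

theorem mem_conjAct_smul_subgroup_iff (c : ConjAct G) (H : Subgroup G) (g : G) :
    g ∈ c • H ↔ (ConjAct.ofConjAct c)⁻¹ * g * ConjAct.ofConjAct c ∈ H := by
  rw [Subgroup.mem_pointwise_smul_iff_inv_smul_mem, ConjAct.smul_def, ConjAct.ofConjAct_inv,
    inv_inv]

instance instContinuousConstSMulConjActSubgroup : ContinuousConstSMul (ConjAct G) (Subgroup G) where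
  continuous_const_smul c := continuous_subgroup_iff.2 fun g => by
    simp only [mem_conjAct_smul_subgroup_iff]
    exact isClopen_setOf_mem_subgroup _

theorem ae_isConjRecurrent [Countable G] (μ : Measure (Subgroup G)) [IsFiniteMeasure μ]
    [SMulInvariantMeasure (ConjAct G) (Subgroup G) μ] : ∀ᵐ H ∂μ, IsConjRecurrent H := by
  have hrec : ∀ h g : G, ∀ᵐ H ∂μ, h ∈ H → ∃ᶠ n : ℕ in atTop, (g ^ n)⁻¹ * h * g ^ n ∈ H := by
    intro h g
    filter_upwards [(measurePreserving_smul (ConjAct.toConjAct g)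
      μ).conservative.ae_mem_imp_frequently_image_mem
        (isClopen_setOf_mem_subgroup h).isOpen.measurableSet.nullMeasurableSet] with H hH hh
    refine (hH hh).mono fun n hn => ?_
    rw [smul_iterate] at hn
    exact (mem_conjAct_smul_subgroup_iff _ H h).1 hn
  filter_upwards [ae_all_iff.2 fun h => ae_all_iff.2 (hrec h)] with H hH h hh g
  exact hH h g hh

theorem isClosed_setOf_subgroup_le (K : Subgroup G) : IsClosed {H : Subgroup G | H ≤ K} := by
  have hset : {H : Subgroup G | H ≤ K} = ⋂ g ∈ (K : Set G)ᶜ, {H : Subgroup G | g ∈ H}ᶜ := by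
    ext H
    simp only [Set.mem_iInter]
    exact forall_congr' fun g => not_imp_not.symm
  rw [hset]
  exact isClosed_biInter fun g _ => (isClopen_setOf_mem_subgroup g).compl.isClosed

theorem ae_subgroup_le_or_ae_not_subgroup_le (μ : Measure (Subgroup G))
    [ErgodicSMul (ConjAct G) (Subgroup G) μ] (K : Subgroup G) [K.Normal] :
    (∀ᵐ H ∂μ, H ≤ K) ∨ ∀ᵐ H ∂μ, ¬ H ≤ K := by
  have hinv : ∀ c : ConjAct G, (c • ·) ⁻¹' {H : Subgroup G | H ≤ K} = {H | H ≤ K} := fun c => by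
    ext H
    rw [Set.mem_preimage, Set.mem_ofPred_eq, Subgroup.pointwise_smul_subset_iff,
      Subgroup.Normal.conjAct ‹_›]
    rfl
  exact eventuallyConst_set.1 (aeconst_of_forall_preimage_smul_ae_eq (ConjAct G)
    (isClosed_setOf_subgroup_le K).measurableSet.nullMeasurableSet fun c => (hinv c).eventuallyEq)

end InvariantRandomSubgroups

theorem mainTheorem4 {G : Type u} [Group G] [Countable G]
    (hG : IsAcylindricallyHyperbolic.{u, v} G)
    (μ : Measure (Subgroup G)) (hμ : IsErgodicIRS μ) :
    IsGreatest {N : Subgroup G | N.Normal ∧ Finite N} (finiteRadical G) ∧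
    (((∀ᵐ H ∂μ, IsTotallyGeometricallyDense.{u, w} H) ∧
        (∀ᵐ H : Subgroup G ∂μ, IsAcylindricallyHyperbolic.{u, v} H)) ∨
      ((∀ᵐ H ∂μ, H ≤ finiteRadical G) ∧ (∀ᵐ H : Subgroup G ∂μ, Finite H))) := by
  have := hμ.isProbabilityMeasure
  have := hμ.ergodicSMul
  have hK := hG.isGreatest_finiteRadical
  obtain ⟨_, _⟩ := hK.1
  refine ⟨hK, ?_⟩
  rcases ae_subgroup_le_or_ae_not_subgroup_le μ (finiteRadical G) with h | h
  · refine Or.inr ⟨h, ?_⟩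
    filter_upwards [h] with H hH
    exact Finite.of_injective _ (Subgroup.inclusion_injective hH)
  · refine Or.inl ⟨?_, ?_⟩
    · filter_upwards [h, ae_isConjRecurrent μ] with H hHK hrec
      exact hrec.isTotallyGeometricallyDense hHK
    · filter_upwards [h, ae_isConjRecurrent μ] with H hHK hrec
      exact (hrec.isTotallyGeometricallyDense hHK).isAcylindricallyHyperbolic hG
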